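/- Let $\Gamma(t)=(t,t^2,t^3)$ and let $\mathbf t(c),\mathbf n(c),\mathbf b(c)$ be the unit tangent, normal and binormal vectors of $\Gamma$ at $\Gamma(c)$. For $R\ge 2$ let $\mathbb I_{R^{-1/3}}$ be the partition of $[0,1]$ into consecutive intervals $I=[c,c+R^{-1/3}]$, $c=0,R^{-1/3},2R^{-1/3},\dots<1$ (the last one may stick out of $[0,1]$), and write $\mathbf t(I)=\mathbf t(c)$, etc. Fix an integer $A\ge 1$. By a $(d_1,d_2,d_3)$-box associated with $I$ we mean a set $B\subset\mathbb R^3$ with $A^{-1}P\subset B\subset AP$, where $P$ is a rectangular box with side lengths $d_1,d_2,d_3$ in the directions $\mathbf t(I),\mathbf n(I),\mathbf b(I)$ and $\lambda P$ is its dilate by the factor $\lambda$ about its center. An $R^{2/3}$-cube is a set $q$ with $A^{-1}P\subset q\subset AP$, where $P$ is a cube of side length $R^{2/3}$ in any orientation. A Vinogradov tube associated with $I$ is an $(R^{2/3},R^{2/3},R)$-box associated with $I$. Let $\mathbb T$ be a finite collection of Vinogradov tubes contained in $[-R,R]^3$, each one associated with some $I\in\mathbb I_{R^{-1/3}}$,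 and let $\mathbb T(I)$ be the set of those associated with $I$. Suppose that $\mathbb T$ is separated: for each $I$, every point of $\mathbb R^3$ lies in at most $A$ tubes of $\mathbb T(I)$. Suppose further that $\mathbb T$ satisfies, for an integer $N\ge 0$, the spacing condition (S1) for each $I\in\mathbb I_{R^{-1/3}}$ there is a cover of $[-R,R]^3$ by $(R^{2/3},R,R)$-boxes associated with $I$ (plates with normal vector $\mathbf t(I)$), with no point of $\mathbb R^3$ in more than $A$ of them, such that each $T\in\mathbb T(I)$ is contained in one of these plates and each of these plates contains at most $N$ tubes $T\in\mathbb T(I)$. Then for each real $r\ge 1$ and each collection $\mathcal Q_r$ of pairwise disjoint $R^{2/3}$-cubes, each of which intersects at least $r$ tubes of $\mathbb T$, the collection $\mathcal Q_r$ is finite and $$|\mathcal Q_r|\le K(\log R)^{B}\,\frac{|\mathbb T|\,N\,R^{1/3}}{r^2},$$ where $B$ is an absolute constant and $K$ depends only on $A$. -/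

import Mathlib

noncomputable section

namespace Vinogradov

/-- Euclidean three-space. -/
abbrev E3 : Type := EuclideanSpace ℝ (Fin 3)

/-! ### The twisted cubic and its Frenet frame -/

/-- The twisted cubic `Γ(t) = (t, t², t³)`. -/
def twistedCubic (t : ℝ) : E3 := !₂[t, t ^ 2, t ^ 3]

/-- The cross product on Euclidean three-space. -/
def cross (u v : E3) : E3 := WithLp.toLp 2 (crossProduct (WithLp.ofLp u) (WithLp.ofLp v))

/-- Normalization of a vector to unit length. -/
def unit (v : E3) : E3 := ‖v‖⁻¹ • v

/-- The unit tangent vector `𝐭` of the twisted cubic at `Γ(c)`. -/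
def tangentVec (c : ℝ) : E3 := unit (deriv twistedCubic c)

/-- The unit binormal vector `𝐛` of the twisted cubic at `Γ(c)`, the direction of `Γ' × Γ''`. -/
def binormalVec (c : ℝ) : E3 :=
  unit (cross (deriv twistedCubic c) (deriv (deriv twistedCubic) c))

/-- The unit normal vector `𝐧 = 𝐛 × 𝐭` of the twisted cubic at `Γ(c)`. -/
def normalVec (c : ℝ) : E3 := cross (binormalVec c) (tangentVec c)

/-- The Frenet frame `(𝐭, 𝐧, 𝐛)` of the twisted cubic at `Γ(c)`. -/
def frenet (c : ℝ) : Fin 3 → E3 := ![tangentVec c, normalVec c, binormalVec c]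

/-! ### Boxes -/

/-- The closed box with center `p`, axes `e 0, e 1, e 2` and side lengths `d 0, d 1, d 2`. -/
def box (e : Fin 3 → E3) (p : E3) (d : Fin 3 → ℝ) : Set E3 :=
  {x | ∀ i, |inner ℝ (e i) (x - p)| ≤ d i / 2}

/-- `B` is an (almost rectangular) `(d 0, d 1, d 2)`-box with axes `e 0, e 1, e 2`, up to the
factor `A`: it lies between the concentric dilates, by the factors `A⁻¹` and `A`, of a rectangular
box with these axes and side lengths. -/
def IsAlmostBox (A : ℝ) (e : Fin 3 → E3) (d : Fin 3 → ℝ) (B : Set E3) : Prop :=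
  ∃ p : E3, box e p (fun i => A⁻¹ * d i) ⊆ B ∧ B ⊆ box e p (fun i => A * d i)

/-- Left endpoints `c` of the consecutive intervals `I = [c, c + R^{-1/3}]`, starting at `0`,
into which `[0, 1]` is partitioned (the last one may stick out if `R^{1/3}` is not an integer).
An interval is represented by its left endpoint. -/
def leftEndpoints (R : ℝ) : Set ℝ :=
  {c | c < 1 ∧ ∃ k : ℕ, c = k * R ^ (-(1 / 3) : ℝ)}

/-- Vinogradov tubes at scale `R` associated with `I = [c, c + R^{-1/3}]`: boxes with dimensions
`(R^{2/3}, R^{2/3}, R)` with respect to the axes `𝐭(I), 𝐧(I), 𝐛(I)`. -/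
def IsTube (A R c : ℝ) (T : Set E3) : Prop :=
  IsAlmostBox A (frenet c) ![R ^ (2 / 3 : ℝ), R ^ (2 / 3 : ℝ), R] T

/-- `(R^{2/3}, R, R)`-plates associated with `I = [c, c + R^{-1/3}]`, with normal vector `𝐭(I)`. -/
def IsPlate (A R c : ℝ) (S : Set E3) : Prop :=
  IsAlmostBox A (frenet c) ![R ^ (2 / 3 : ℝ), R, R] S

/-- Cubes (of arbitrary orientation) with side length comparable to `R^{2/3}`. -/
def IsCube (A R : ℝ) (q : Set E3) : Prop :=
  ∃ e : OrthonormalBasis (Fin 3) ℝ E3, IsAlmostBox A e (fun _ => R ^ (2 / 3 : ℝ)) q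

/-- The cube `[-R, R]³`. -/
def bigCube (R : ℝ) : Set E3 := {x | ∀ i, |x i| ≤ R}

/-! ### Families of tubes

A tube is recorded as a pair `(c, T)`: the left endpoint `c` of the interval `I` it is associated
with, and the set `T`. -/

/-- A collection of sets has overlap at most `A`: no point lies in more than `A` of them. -/
def OverlapLE (A : ℕ) (𝒮 : Set (Set E3)) : Prop :=
  ∀ x : E3, {S | S ∈ 𝒮 ∧ x ∈ S}.encard ≤ A

/-- The collection `𝕋(I)` of the tubes in `𝕋` associated with `I = [c, c + R^{-1/3}]`. -/
def tubesAt (𝕋 : Finset (ℝ × Set E3)) (c : ℝ) : Set (Set E3) := {T | (c, T) ∈ 𝕋}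

/-- `𝕋` is a separated family of Vinogradov tubes at scale `R` in `[-R, R]³`: for each interval,
the tubes associated with it have bounded overlap. -/
structure IsSeparatedTubeFamily (A : ℕ) (R : ℝ) (𝕋 : Finset (ℝ × Set E3)) : Prop where
  tube : ∀ τ ∈ 𝕋, τ.1 ∈ leftEndpoints R ∧ IsTube A R τ.1 τ.2 ∧ τ.2 ⊆ bigCube R
  separated : ∀ c ∈ leftEndpoints R, OverlapLE A (tubesAt 𝕋 c)

/-- The spacing condition (S1) with parameter `N`: for each interval `I = [c, c + R^{-1/3}]`, the
cube `[-R, R]³` is covered by boundedly overlapping `(R^{2/3}, R, R)`-plates with normal vector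
`𝐭(I)`, such that each tube in `𝕋(I)` sits inside one of these plates and each of these plates
contains at most `N` tubes in `𝕋(I)`. -/
def SpacingS1 (A : ℕ) (R : ℝ) (N : ℕ) (𝕋 : Finset (ℝ × Set E3)) : Prop :=
  ∀ c ∈ leftEndpoints R, ∃ 𝒮 : Set (Set E3),
    (∀ S ∈ 𝒮, IsPlate A R c S) ∧
    OverlapLE A 𝒮 ∧
    bigCube R ⊆ ⋃₀ 𝒮 ∧
    (∀ T ∈ tubesAt 𝕋 c, ∃ S ∈ 𝒮, T ⊆ S) ∧
    (∀ S ∈ 𝒮, {T | T ∈ tubesAt 𝕋 c ∧ T ⊆ S}.encard ≤ N)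

/-- `q` is `r`-rich: it intersects at least `r` tubes in `𝕋`. -/
def IsRich (𝕋 : Finset (ℝ × Set E3)) (r : ℝ) (q : Set E3) : Prop :=
  r ≤ ({τ | τ ∈ 𝕋 ∧ (τ.2 ∩ q).Nonempty}.ncard : ℝ)

end Vinogradov

end

noncomputable section

namespace Vinogradov

/-! ### Frenet geometry of the twisted cubic -/

/-! The proof is a double count. Put h = R^{1/3}. The sum over cubes of the squared number of tubes
met is at least |𝒬| r², and it equals the sum over ordered pairs of tubes of the number of cubes
meeting both. Two tubes whose directions are k steps apart share ≲ h/(1+k) disjoint cubes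
(`card_cubes_le`). They share none unless their centers are within ≲ h² of each other along
`commonNormal`, which is orthogonal to both long axes (`abs_inner_commonNormal_sub_le`).

Sort the centers into bins of width h² along `commonNormal`. Since ab ≤ a² + b², pairs with
directions k and l in nearby bins are dominated by pairs of parallel tubes in a common bin, summed
over the auxiliary direction l (`sum_near_pairs_le`). For parallel tubes with displacement u,
`commonNormal` is affine in the auxiliary direction, so a common bin forces |x + (l-k)y| ≤ 1, where
x is the velocity component of u divided by h² and y is bounded. The sum of 1/(1+|l-k|) over such l
is ≲ log R/(1+|x|) (`sum_filter_inv_one_add_abs_le`).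

Finally, x measures position along the tangent in units of the plate thickness, so (S1) allows ≲ N
tubes per unit interval of x (`card_le_of_spacing`), and summing 1/(1+|x|) over them costs N log R.
Altogether |𝒬| r² ≲ |𝕋| N h (log R)². -/

/-- The derivative `Γ'(c)`. -/
def velocity (c : ℝ) : E3 := !₂[1, 2 * c, 3 * c ^ 2]

/-- A polynomial multiple of the binormal vector at `Γ(c)`. -/
def binormalDir (c : ℝ) : E3 := !₂[3 * c ^ 2, -(3 * c), 1]

/-- A vector orthogonal to the binormal vectors at both `Γ(c)` and `Γ(d)`. -/
def commonNormal (c d : ℝ) : E3 := !₂[1, c + d, 3 * c * d]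

/-- A vector orthogonal to the binormal vector at `Γ(c)`. -/
def transverse (c : ℝ) : E3 := !₂[0, 1, 3 * c]

theorem inner_E3 (x y : E3) : inner ℝ x y = x 0 * y 0 + x 1 * y 1 + x 2 * y 2 := by
  simp [PiLp.inner_apply, Fin.sum_univ_three, mul_comm]

theorem norm_sq_E3 (x : E3) : ‖x‖ ^ 2 = x 0 ^ 2 + x 1 ^ 2 + x 2 ^ 2 := by
  rw [← real_inner_self_eq_norm_sq, inner_E3]; ring

theorem deriv_twistedCubic : deriv twistedCubic = velocity := by
  funext c
  refine HasDerivAt.deriv ?_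
  have h : HasDerivAt (fun t : ℝ => (![t, t ^ 2, t ^ 3] : Fin 3 → ℝ)) ![1, 2 * c, 3 * c ^ 2] c := by
    rw [hasDerivAt_pi]
    intro i
    fin_cases i
    · exact hasDerivAt_id c
    · simpa using hasDerivAt_pow 2 c
    · simpa using hasDerivAt_pow 3 c
  exact (PiLp.hasFDerivAt_toLp (𝕜 := ℝ) 2 _).comp_hasDerivAt c h

theorem deriv_velocity (c : ℝ) : deriv velocity c = !₂[0, 2, 6 * c] := by
  refine HasDerivAt.deriv ?_
  have h : HasDerivAt (fun t : ℝ => (![1, 2 * t, 3 * t ^ 2] : Fin 3 → ℝ)) ![0, 2, 6 * c] c := by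
    rw [hasDerivAt_pi]
    intro i
    fin_cases i
    · simpa using hasDerivAt_const c (1 : ℝ)
    · simpa using (hasDerivAt_id c).const_mul 2
    · exact ((hasDerivAt_pow 2 c).const_mul (3 : ℝ)).congr_deriv (by norm_num; ring)
  exact (PiLp.hasFDerivAt_toLp (𝕜 := ℝ) 2 _).comp_hasDerivAt c h

theorem unit_smul_of_pos {a : ℝ} (ha : 0 < a) (v : E3) : unit (a • v) = unit v := by
  unfold unit
  rw [norm_smul, smul_smul, Real.norm_of_nonneg ha.le, mul_inv, mul_assoc, mul_comm, mul_assoc,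
    mul_inv_cancel₀ ha.ne', mul_one]

theorem norm_unit {v : E3} (hv : v ≠ 0) : ‖unit v‖ = 1 := by
  unfold unit
  rw [norm_smul, norm_inv, norm_norm, inv_mul_cancel₀ (norm_ne_zero_iff.2 hv)]

theorem tangentVec_eq (c : ℝ) : tangentVec c = unit (velocity c) := by
  rw [tangentVec, deriv_twistedCubic]

theorem binormalVec_eq (c : ℝ) : binormalVec c = unit (binormalDir c) := by
  -- Γ' × Γ'' is twice `binormalDir`; the factor disappears on normalizing.
  rw [binormalVec, deriv_twistedCubic, deriv_velocity,
    ← unit_smul_of_pos (two_pos : (0 : ℝ) < 2) (binormalDir c)]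
  congr 1
  ext i
  fin_cases i <;> simp [cross, velocity, binormalDir, crossProduct] <;> ring

theorem one_le_norm_velocity (c : ℝ) : 1 ≤ ‖velocity c‖ := by
  have h : ‖velocity c‖ ^ 2 = 1 + (2 * c) ^ 2 + (3 * c ^ 2) ^ 2 := by
    rw [norm_sq_E3]; simp [velocity]
  nlinarith [norm_nonneg (velocity c), sq_nonneg (2 * c), sq_nonneg (3 * c ^ 2)]

theorem one_le_norm_binormalDir (c : ℝ) : 1 ≤ ‖binormalDir c‖ := by
  have h : ‖binormalDir c‖ ^ 2 = (3 * c ^ 2) ^ 2 + (3 * c) ^ 2 + 1 := by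
    rw [norm_sq_E3]; simp [binormalDir]
  nlinarith [norm_nonneg (binormalDir c), sq_nonneg (3 * c), sq_nonneg (3 * c ^ 2)]

theorem ne_zero_of_one_le_norm {v : E3} (h : 1 ≤ ‖v‖) : v ≠ 0 := by
  rintro rfl
  norm_num at h

/-- The unit length of the cross product is Lagrange's identity |u × v|² = |u|²|v|² - (u·v)². -/
theorem orthonormal_cross {u v : E3} (hu : ‖u‖ = 1) (hv : ‖v‖ = 1) (huv : inner ℝ u v = 0) :
    Orthonormal ℝ ![v, cross u v, u] := by
  have hu2 := norm_sq_E3 u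
  have hv2 := norm_sq_E3 v
  have huv' := huv
  rw [inner_E3] at huv'
  rw [hu] at hu2
  rw [hv] at hv2
  have hvw : inner ℝ v (cross u v) = 0 := by
    rw [inner_E3]; simp [cross, crossProduct]; ring
  have huw : inner ℝ u (cross u v) = 0 := by
    rw [inner_E3]; simp [cross, crossProduct]; ring
  have hw : ‖cross u v‖ = 1 := by
    have h : ‖cross u v‖ ^ 2 = 1 := by
      rw [norm_sq_E3]
      simp [cross, crossProduct]
      linear_combination (-(v 0 ^ 2 + v 1 ^ 2 + v 2 ^ 2)) * hu2 - hv2 -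
        (u 0 * v 0 + u 1 * v 1 + u 2 * v 2) * huv'
    nlinarith [norm_nonneg (cross u v)]
  constructor
  · intro i
    fin_cases i
    exacts [hv, hw, hu]
  · intro i j hij
    fin_cases i <;> fin_cases j <;> first | exact absurd rfl hij | skip
    exacts [hvw, (real_inner_comm _ _).trans huv, (real_inner_comm _ _).trans hvw,
      (real_inner_comm _ _).trans huw, huv, huw]

theorem exists_orthonormalBasis_frenet (c : ℝ) :
    ∃ e : OrthonormalBasis (Fin 3) ℝ E3, ⇑e = frenet c := by
  have horth : Orthonormal ℝ (frenet c) := by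
    refine orthonormal_cross ?_ ?_ ?_
    · rw [binormalVec_eq]; exact norm_unit (ne_zero_of_one_le_norm (one_le_norm_binormalDir c))
    · rw [tangentVec_eq]; exact norm_unit (ne_zero_of_one_le_norm (one_le_norm_velocity c))
    · rw [binormalVec_eq, tangentVec_eq, unit, unit, inner_smul_left, inner_smul_right, inner_E3]
      simp [binormalDir, velocity]
      ring_nf
  have hcard : Module.finrank ℝ E3 = Fintype.card (Fin 3) := by simp
  obtain ⟨e, he⟩ := Orthonormal.exists_orthonormalBasis_extension_of_card_eq hcard.symm.symm
    (v := frenet c) (s := Set.univ) (horth.comp _ Subtype.val_injective)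
  exact ⟨e, funext fun i => he i (Set.mem_univ i)⟩

theorem inner_binormalVec (c : ℝ) (m : E3) :
    inner ℝ m (binormalVec c) = ‖binormalDir c‖⁻¹ * inner ℝ m (binormalDir c) := by
  rw [binormalVec_eq, unit, inner_smul_right]

/-- The component of a vector along a direction orthogonal to the binormal is controlled by
its components along the tangent and the normal. -/
theorem abs_inner_le_of_inner_binormalDir_eq_zero {c a M : ℝ} {m u : E3}
    (hm : inner ℝ m (binormalDir c) = 0) (hM : ‖m‖ ≤ M)
    (h0 : |inner ℝ (frenet c 0) u| ≤ a) (h1 : |inner ℝ (frenet c 1) u| ≤ a) :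
    |inner ℝ m u| ≤ 2 * M * a := by
  obtain ⟨e, he⟩ := exists_orthonormalBasis_frenet c
  have hb : inner ℝ m (e 2) = 0 := by
    rw [he]; exact (inner_binormalVec c m).trans (by rw [hm, mul_zero])
  rw [← he] at h0 h1
  have hle (i : Fin 3) : |inner ℝ m (e i)| ≤ M :=
    (abs_real_inner_le_norm _ _).trans (by rw [e.norm_eq_one, mul_one]; exact hM)
  have hM0 : 0 ≤ M := (norm_nonneg m).trans hM
  rw [← e.sum_inner_mul_inner m u, Fin.sum_univ_three, hb, zero_mul, add_zero]
  refine (abs_add_le _ _).trans ?_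
  rw [abs_mul, abs_mul]
  have := mul_le_mul (hle 0) h0 (abs_nonneg _) hM0
  have := mul_le_mul (hle 1) h1 (abs_nonneg _) hM0
  linarith

/-- Against `binormalDir t`, the vector `commonNormal c d` gives 3(t - c)(t - d), which vanishes at
both parameters. -/
theorem inner_commonNormal_binormalDir_left (c d : ℝ) :
    inner ℝ (commonNormal c d) (binormalDir c) = 0 := by
  rw [inner_E3]; simp [commonNormal, binormalDir]; ring

theorem commonNormal_comm (c d : ℝ) : commonNormal c d = commonNormal d c := by
  simp only [commonNormal, add_comm c d, mul_assoc, mul_comm c d]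

theorem norm_le_four_of_sq {v : E3} (h : v 0 ^ 2 + v 1 ^ 2 + v 2 ^ 2 ≤ 16) : ‖v‖ ≤ 4 := by
  rw [← norm_sq_E3] at h
  nlinarith [norm_nonneg v]

theorem norm_commonNormal_le {c d : ℝ} (hc : c ∈ Set.Icc (0 : ℝ) 1) (hd : d ∈ Set.Icc (0 : ℝ) 1) :
    ‖commonNormal c d‖ ≤ 4 := by
  obtain ⟨hc0, hc1⟩ := hc
  obtain ⟨hd0, hd1⟩ := hd
  apply norm_le_four_of_sq
  simp [commonNormal]
  have h1 : c * d ≤ 1 := mul_le_one₀ hc1 hd0 hd1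
  have h0 : 0 ≤ c * d := mul_nonneg hc0 hd0
  nlinarith

theorem norm_transverse_le {c : ℝ} (hc : c ∈ Set.Icc (0 : ℝ) 1) : ‖transverse c‖ ≤ 4 := by
  obtain ⟨hc0, hc1⟩ := hc
  apply norm_le_four_of_sq
  simp [transverse]
  nlinarith

theorem norm_binormalDir_le {c : ℝ} (hc : c ∈ Set.Icc (0 : ℝ) 1) : ‖binormalDir c‖ ≤ 5 := by
  obtain ⟨hc0, hc1⟩ := hc
  have h : ‖binormalDir c‖ ^ 2 = (3 * c ^ 2) ^ 2 + (3 * c) ^ 2 + 1 := by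
    rw [norm_sq_E3]; simp [binormalDir]
  have h2 : c ^ 2 ≤ 1 := by nlinarith
  nlinarith [norm_nonneg (binormalDir c), sq_nonneg (c ^ 2), sq_nonneg c]

theorem norm_velocity_le {c : ℝ} (hc : c ∈ Set.Icc (0 : ℝ) 1) : ‖velocity c‖ ≤ 4 := by
  obtain ⟨hc0, hc1⟩ := hc
  apply norm_le_four_of_sq
  simp [velocity]
  have h2 : c ^ 2 ≤ 1 := by nlinarith
  nlinarith [sq_nonneg (c ^ 2), sq_nonneg c]

/-- For fixed c the common normal moves on a line as d varies, starting from Γ'(c). This turns the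
bin condition into a linear inequality in the index of d. -/
theorem inner_commonNormal (c d : ℝ) (v : E3) :
    inner ℝ (commonNormal c d) v = inner ℝ (velocity c) v + (d - c) * inner ℝ (transverse c) v := by
  simp only [inner_E3]
  simp [commonNormal, velocity, transverse]
  ring

/-- A vector that is nearly parallel to two binormal directions is short. -/
theorem abs_sub_mul_abs_inner_binormal_le {c d a : ℝ} {u : E3} (hc : c ∈ Set.Icc (0 : ℝ) 1)
    (hd : d ∈ Set.Icc (0 : ℝ) 1)
    (hc0 : |inner ℝ (frenet c 0) u| ≤ a) (hc1 : |inner ℝ (frenet c 1) u| ≤ a)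
    (hd0 : |inner ℝ (frenet d 0) u| ≤ a) (hd1 : |inner ℝ (frenet d 1) u| ≤ a) :
    |d - c| * |inner ℝ (frenet c 2) u| ≤ 40 * a := by
  obtain ⟨e, he⟩ := exists_orthonormalBasis_frenet c
  have hort : inner ℝ (transverse d) (binormalDir d) = 0 := by
    rw [inner_E3]; simp [transverse, binormalDir]
  have h1 := abs_inner_le_of_inner_binormalDir_eq_zero hort (norm_transverse_le hd) hd0 hd1
  -- The angular separation enters here: `transverse d` kills the binormal at d but has component
  -- proportional to d - c along the binormal at c.
  have hb : inner ℝ (transverse d) (e 2) = ‖binormalDir c‖⁻¹ * (3 * (d - c)) := by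
    rw [he]
    refine (inner_binormalVec c _).trans ?_
    congr 1
    rw [inner_E3]; simp [transverse, binormalDir]; ring
  have hle (i : Fin 3) : |inner ℝ (transverse d) (e i)| ≤ 4 :=
    (abs_real_inner_le_norm _ _).trans (by
      rw [e.norm_eq_one, mul_one]; exact norm_transverse_le hd)
  rw [← he] at hc0 hc1 ⊢
  have hsum := e.sum_inner_mul_inner (transverse d) u
  rw [Fin.sum_univ_three] at hsum
  have h2 : |inner ℝ (transverse d) (e 2) * inner ℝ (e 2) u| ≤ 16 * a := by
    have e2 : inner ℝ (transverse d) (e 2) * inner ℝ (e 2) u = inner ℝ (transverse d) u -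
      inner ℝ (transverse d) (e 0) * inner ℝ (e 0) u -
      inner ℝ (transverse d) (e 1) * inner ℝ (e 1) u := by linarith
    have h3 := mul_le_mul (hle 0) hc0 (abs_nonneg _) (by norm_num)
    have h4 := mul_le_mul (hle 1) hc1 (abs_nonneg _) (by norm_num)
    rw [← abs_mul] at h3 h4
    rw [e2]
    rw [abs_le] at *
    constructor <;> linarith [h1.1, h1.2, h3.1, h3.2, h4.1, h4.2]
  have hpos : 0 < ‖binormalDir c‖ := by linarith [one_le_norm_binormalDir c]
  have h5 := norm_binormalDir_le hc
  rw [hb, abs_mul, abs_mul, abs_mul, abs_of_pos (inv_pos.2 hpos), abs_of_pos three_pos,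
    mul_assoc, inv_mul_le_iff₀ hpos] at h2
  have ha : 0 ≤ a := (abs_nonneg _).trans hc0
  have h6 := mul_le_mul_of_nonneg_right h5 (by positivity : 0 ≤ 16 * a)
  linarith

/-! ### Counting lemmas -/

theorem card_le_of_forall_abs_sub_le {s : Finset ℤ} {d : ℝ} (hd : 0 ≤ d)
    (h : ∀ a ∈ s, ∀ b ∈ s, |((a - b : ℤ) : ℝ)| ≤ d) : (s.card : ℝ) ≤ d + 1 := by
  rcases s.eq_empty_or_nonempty with rfl | hs
  · simp; linarith
  have hsub : s ⊆ Finset.Icc (s.min' hs) (s.max' hs) := fun a ha =>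
    Finset.mem_Icc.2 ⟨s.min'_le a ha, s.le_max' a ha⟩
  have hcard := Finset.card_le_card hsub
  rw [Int.card_Icc] at hcard
  have hle : s.min' hs ≤ s.max' hs := s.min'_le _ (s.max'_mem hs)
  have h1 : (s.card : ℤ) ≤ s.max' hs + 1 - s.min' hs := by omega
  have h2 : (s.card : ℝ) ≤ s.max' hs + 1 - s.min' hs := by exact_mod_cast h1
  have h3 := (abs_le.1 (h _ (s.max'_mem hs) _ (s.min'_mem hs))).2
  push_cast at h3
  linarith

theorem abs_floor_sub_floor_le (x y : ℝ) : |((⌊x⌋ - ⌊y⌋ : ℤ) : ℝ)| ≤ |x - y| + 1 := by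
  push_cast
  have h1 := Int.floor_le x
  have h2 := Int.lt_floor_add_one x
  have h3 := Int.floor_le y
  have h4 := Int.lt_floor_add_one y
  have h5 := le_abs_self (x - y)
  have h6 := neg_abs_le (x - y)
  rw [abs_le]
  constructor <;> linarith

/-- A family of sets of bounded overlap, each containing a box of half-widths `ρ`, with centers
in a box with side lengths `a`, is finite with a bound on its cardinality. -/
theorem card_le_of_overlap {ι : Type*} (s : Finset ι) (e : OrthonormalBasis (Fin 3) ℝ E3)
    (p : ι → E3) (S : ι → Set E3) (ρ a : Fin 3 → ℝ) (A : ℕ) (hρ : ∀ k, 0 < ρ k)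
    (ha : ∀ k, 0 ≤ a k)
    (hbox : ∀ i ∈ s, box e (p i) (fun k => 2 * ρ k) ⊆ S i)
    (hA : ∀ x, ∀ t ⊆ s, (∀ i ∈ t, x ∈ S i) → t.card ≤ A)
    (hdist : ∀ i ∈ s, ∀ j ∈ s, ∀ k, |inner ℝ (e k) (p i - p j)| ≤ a k) :
    (s.card : ℝ) ≤ A * ∏ k, (a k / (2 * ρ k) + 2) := by
  classical
  -- Round the centers to a grid of cells with side lengths 2ρ.
  let f : ι → Fin 3 → ℤ := fun i k => ⌊inner ℝ (e k) (p i) / (2 * ρ k)⌋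
  have hfib : s.card ≤ A * (s.image f).card := by
    refine Finset.card_le_mul_card_image s A fun g _ => ?_
    -- The midpoint of a cell lies in every set whose center is in that cell, so the overlap bound
    -- limits the fibre.
    refine hA (∑ k, (2 * ρ k * (g k + 1 / 2)) • e k) _ (Finset.filter_subset _ _) ?_
    intro i hi
    rw [Finset.mem_filter] at hi
    refine hbox i hi.1 fun k => ?_
    have hk : inner ℝ (e k) (∑ k, (2 * ρ k * ((g k : ℝ) + 1 / 2)) • e k) =
        2 * ρ k * (g k + 1 / 2) := by
      rw [e.orthonormal.inner_right_fintype]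
    rw [inner_sub_right, hk, ← hi.2]
    have h2 : 0 < 2 * ρ k := by linarith [hρ k]
    have h3 := Int.floor_le (inner ℝ (e k) (p i) / (2 * ρ k))
    have h4 := Int.lt_floor_add_one (inner ℝ (e k) (p i) / (2 * ρ k))
    rw [le_div_iff₀ h2] at h3
    rw [div_lt_iff₀ h2] at h4
    rw [abs_le]
    simp only [f]
    constructor <;> linarith
  have himg : s.image f ⊆ Fintype.piFinset fun k => s.image fun i => f i k := by
    intro g hg
    obtain ⟨i, hi, rfl⟩ := Finset.mem_image.1 hg
    exact Fintype.mem_piFinset.2 fun k => Finset.mem_image_of_mem (fun i => f i k) hi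
  have hcard := Finset.card_le_card himg
  rw [Fintype.card_piFinset] at hcard
  -- Of the extra 2, one comes from rounding and one from counting both endpoints.
  have hk (k : Fin 3) : ((s.image fun i => f i k).card : ℝ) ≤ a k / (2 * ρ k) + 2 := by
    have h2 : 0 < 2 * ρ k := by linarith [hρ k]
    have h := card_le_of_forall_abs_sub_le (s := s.image fun i => f i k)
      (d := a k / (2 * ρ k) + 1) (by have := div_nonneg (ha k) h2.le; linarith) ?_
    · linarith
    intro m hm n hn
    obtain ⟨i, hi, rfl⟩ := Finset.mem_image.1 hm
    obtain ⟨j, hj, rfl⟩ := Finset.mem_image.1 hn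
    refine (abs_floor_sub_floor_le _ _).trans ?_
    rw [← sub_div, ← inner_sub_right, abs_div, abs_of_pos h2]
    have := div_le_div_of_nonneg_right (hdist i hi j hj k) h2.le
    linarith
  calc (s.card : ℝ) ≤ ((A * (s.image f).card : ℕ) : ℝ) := by exact_mod_cast hfib
    _ ≤ A * ∏ k, ((s.image fun i => f i k).card : ℝ) := by
      push_cast
      refine mul_le_mul_of_nonneg_left ?_ (Nat.cast_nonneg A)
      exact_mod_cast hcard
    _ ≤ A * ∏ k, (a k / (2 * ρ k) + 2) := by
      refine mul_le_mul_of_nonneg_left ?_ (Nat.cast_nonneg A)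
      exact Finset.prod_le_prod (fun k _ => Nat.cast_nonneg _) fun k _ => hk k

/-! ### Logarithmic sums -/

theorem sum_Icc_inv_one_add_abs_le (n : ℕ) :
    ∑ k ∈ Finset.Icc (-(n : ℤ)) n, (1 + |(k : ℝ)|)⁻¹ ≤ 2 * (1 + Real.log (n + 1)) := by
  have hharm : ∑ k ∈ Finset.range (n + 1), (1 + (k : ℝ))⁻¹ ≤ 1 + Real.log (n + 1) := by
    have h := harmonic_le_one_add_log (n + 1)
    simp only [harmonic, Rat.cast_sum] at h
    push_cast at h
    refine le_trans (le_of_eq ?_) h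
    exact Finset.sum_congr rfl fun k _ => by rw [add_comm]
  have hsub : Finset.Icc (-(n : ℤ)) n ⊆ (Finset.range (n + 1)).image (fun k : ℕ => (k : ℤ)) ∪
      (Finset.range (n + 1)).image (fun k : ℕ => -(k : ℤ)) := by
    intro k hk
    rw [Finset.mem_Icc] at hk
    simp only [Finset.mem_union, Finset.mem_image, Finset.mem_range]
    rcases le_total 0 k with h0 | h0
    · exact Or.inl ⟨k.toNat, by omega, by omega⟩
    · exact Or.inr ⟨(-k).toNat, by omega, by omega⟩
  have hnn (k : ℤ) : (0 : ℝ) ≤ (1 + |(k : ℝ)|)⁻¹ := by positivity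
  refine (Finset.sum_le_sum_of_subset_of_nonneg hsub fun k _ _ => hnn k).trans ?_
  refine (le_of_le_of_eq (le_add_of_nonneg_right (Finset.sum_nonneg fun k _ => hnn k))
    (Finset.sum_union_inter)).trans ?_
  rw [Finset.sum_image (by intro a _ b _ h; simpa using h),
    Finset.sum_image (by intro a _ b _ h; simpa using h)]
  have h1 : ∑ k ∈ Finset.range (n + 1), (1 + |(((k : ℕ) : ℤ) : ℝ)|)⁻¹ =
      ∑ k ∈ Finset.range (n + 1), (1 + (k : ℝ))⁻¹ :=
    Finset.sum_congr rfl fun k _ => by simp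
  have h2 : ∑ k ∈ Finset.range (n + 1), (1 + |((-((k : ℕ) : ℤ) : ℤ) : ℝ)|)⁻¹ =
      ∑ k ∈ Finset.range (n + 1), (1 + (k : ℝ))⁻¹ :=
    Finset.sum_congr rfl fun k _ => by simp
  rw [h1, h2]
  linarith

/-- Sum of `1 / (1 + |k|)` over the integers with `|x + k y| ≤ 1`. -/
theorem sum_filter_inv_one_add_abs_le {x y Y : ℝ} (hY : |y| ≤ Y) (n : ℕ) :
    ∑ k ∈ (Finset.Icc (-(n : ℤ)) n).filter (fun k : ℤ => |x + k * y| ≤ 1), (1 + |(k : ℝ)|)⁻¹ ≤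
      (6 + 3 * Y) * (1 + Real.log (n + 1)) * (1 + |x|)⁻¹ := by
  have hY0 : 0 ≤ Y := (abs_nonneg y).trans hY
  have hlog : 0 ≤ Real.log (n + 1) := Real.log_nonneg (by linarith [(Nat.cast_nonneg n : (0:ℝ) ≤ n)])
  have hx1 : 0 < 1 + |x| := by positivity
  -- For small |x| the full harmonic sum suffices. For large |x| the admissible k are far from 0 and
  -- few, so no logarithm is needed.
  rcases le_or_gt |x| 2 with hx | hx
  · refine (Finset.sum_le_sum_of_subset_of_nonneg (Finset.filter_subset _ _)
      fun k _ _ => by positivity).trans ((sum_Icc_inv_one_add_abs_le n).trans ?_)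
    rw [← div_eq_mul_inv, le_div_iff₀ hx1]
    nlinarith [mul_nonneg hY0 hlog]
  · rw [← div_eq_mul_inv, le_div_iff₀ hx1]
    -- Here |k y| ≥ |x| - 1 ≥ |x|/2, so each weight is at most 2|y|/|x|.
    have hterm : ∀ k ∈ (Finset.Icc (-(n : ℤ)) n).filter (fun k : ℤ => |x + k * y| ≤ 1),
        |x| / 2 ≤ |(k : ℝ)| * |y| := by
      intro k hk
      have h := (Finset.mem_filter.1 hk).2
      have h1 : |x| ≤ |x + k * y| + |k * y| := by
        have := abs_sub (x + k * y) (k * y)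
        simpa using this
      rw [abs_mul] at h1
      linarith
    rcases eq_or_ne y 0 with rfl | hy
    · rw [Finset.sum_eq_zero fun k hk => by
        have := hterm k hk
        rw [abs_zero, mul_zero] at this
        linarith, zero_mul]
      positivity
    have hy' : 0 < |y| := abs_pos.2 hy
    have hcard : (((Finset.Icc (-(n : ℤ)) n).filter
        (fun k : ℤ => |x + k * y| ≤ 1)).card : ℝ) ≤ 2 / |y| + 1 := by
      refine card_le_of_forall_abs_sub_le (by positivity) fun a ha b hb => ?_
      have h1 := (Finset.mem_filter.1 ha).2
      have h2 := (Finset.mem_filter.1 hb).2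
      rw [le_div_iff₀ hy', ← abs_mul]
      push_cast
      rw [abs_le] at *
      constructor <;> linarith [h1.1, h1.2, h2.1, h2.2]
    have hsum : ∑ k ∈ (Finset.Icc (-(n : ℤ)) n).filter (fun k : ℤ => |x + k * y| ≤ 1),
        (1 + |(k : ℝ)|)⁻¹ ≤ (2 / |y| + 1) * (2 * |y| / |x|) := by
      refine (Finset.sum_le_card_nsmul _ _ (2 * |y| / |x|) fun k hk => ?_).trans ?_
      · have h := hterm k hk
        have hx0 : 0 < |x| := by linarith
        rw [inv_le_comm₀ (by positivity) (by positivity), inv_div, div_le_iff₀ (by positivity)]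
        nlinarith
      · rw [nsmul_eq_mul]
        exact mul_le_mul_of_nonneg_right hcard (by positivity)
    -- The number of admissible k grows like 1/|y| while the weight decays like |y|, so the bound is
    -- uniform as y tends to 0.
    have heq : (2 / |y| + 1) * (2 * |y| / |x|) = (4 + 2 * |y|) / |x| := by
      field_simp; ring
    rw [heq] at hsum
    have hx0 : 0 < |x| := by linarith
    calc _ ≤ (4 + 2 * |y|) / |x| * (1 + |x|) := mul_le_mul_of_nonneg_right hsum hx1.le
      _ ≤ (4 + 2 * Y) / |x| * (3 / 2 * |x|) := by
        refine mul_le_mul ?_ (by linarith) hx1.le (by positivity)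
        exact div_le_div_of_nonneg_right (by linarith) hx0.le
      _ = 6 + 3 * Y := by field_simp; ring
      _ ≤ (6 + 3 * Y) * (1 + Real.log (n + 1)) := by
        nlinarith [mul_nonneg (by positivity : 0 ≤ 6 + 3 * Y) hlog]

/-- If each unit interval contains at most `P` of the numbers `x i`, then the sum of
`1 / (1 + |x i|)` is at most logarithmic. -/
theorem sum_inv_one_add_abs_le {ι : Type*} (s : Finset ι) (x : ι → ℝ) (n : ℕ) {P : ℝ}
    (hP : 0 ≤ P)
    (hx : ∀ i ∈ s, |x i| + 1 ≤ n)
    (hcard : ∀ k : ℤ, ((s.filter fun i => ⌊x i⌋ = k).card : ℝ) ≤ P) :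
    ∑ i ∈ s, (1 + |x i|)⁻¹ ≤ 4 * P * (1 + Real.log (n + 1)) := by
  classical
  have hfl (i : ι) : |((⌊x i⌋ : ℤ) : ℝ)| ≤ |x i| + 1 := by
    have := abs_floor_sub_floor_le (x i) 0
    simpa using this
  have hmaps : ∀ i ∈ s, ⌊x i⌋ ∈ Finset.Icc (-(n : ℤ)) n := by
    intro i hi
    have h := abs_le.1 ((hfl i).trans (hx i hi))
    rw [Finset.mem_Icc]
    constructor
    · have := h.1; exact_mod_cast this
    · exact_mod_cast h.2
  rw [← Finset.sum_fiberwise_of_maps_to hmaps]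
  -- Replacing x by its floor costs a factor 2, since 1 + |⌊x⌋| ≤ 2 + |x|.
  calc _ ≤ ∑ k ∈ Finset.Icc (-(n : ℤ)) n, P * (2 * (1 + |(k : ℝ)|)⁻¹) := by
        refine Finset.sum_le_sum fun k _ => ?_
        refine (Finset.sum_le_card_nsmul _ _ (2 * (1 + |(k : ℝ)|)⁻¹) fun i hi => ?_).trans ?_
        · have h := hfl i
          rw [(Finset.mem_filter.1 hi).2] at h
          rw [← div_eq_mul_inv, inv_le_comm₀ (by positivity) (by positivity), inv_div,
            div_le_iff₀ two_pos]
          linarith [abs_nonneg (x i)]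
        · rw [nsmul_eq_mul]
          exact mul_le_mul_of_nonneg_right (hcard k) (by positivity)
    _ = 2 * P * ∑ k ∈ Finset.Icc (-(n : ℤ)) n, (1 + |(k : ℝ)|)⁻¹ := by
        rw [Finset.mul_sum]; exact Finset.sum_congr rfl fun k _ => by ring
    _ ≤ 2 * P * (2 * (1 + Real.log (n + 1))) :=
        mul_le_mul_of_nonneg_left (sum_Icc_inv_one_add_abs_le n) (by positivity)
    _ = _ := by ring

/-! ### Reducing pairs in nearby bins to pairs in one bin -/

/-- Both sides count ordered pairs with equal values of f. -/
theorem sum_card_filter_eq {ι : Type*} (s : Finset ι) (f : ι → ℤ) (I : Finset ℤ)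
    (hI : ∀ i ∈ s, f i ∈ I) :
    ∑ k ∈ I, ((s.filter fun i => f i = k).card : ℝ) ^ 2 =
      ∑ i ∈ s, ((s.filter fun i' => f i' = f i).card : ℝ) := by
  classical
  rw [← Finset.sum_fiberwise_of_maps_to hI]
  refine Finset.sum_congr rfl fun k _ => ?_
  rw [Finset.sum_congr rfl (g := fun _ => ((s.filter fun i => f i = k).card : ℝ))
    fun i hi => by rw [(Finset.mem_filter.1 hi).2], Finset.sum_const, nsmul_eq_mul, sq]

/-- The number of pairs in nearby bins is controlled by the number of pairs sharing a bin. -/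
theorem sum_card_near_le {ι : Type*} (s t : Finset ι) (f : ι → ℤ) (D : ℕ) :
    ∑ i ∈ s, ((t.filter fun j => |f i - f j| ≤ D).card : ℝ) ≤
      (2 * D + 1) * (∑ i ∈ s, ((s.filter fun i' => f i' = f i).card : ℝ) +
        ∑ j ∈ t, ((t.filter fun j' => f j' = f j).card : ℝ)) := by
  classical
  set I := (s ∪ t).image f with hIdef
  have hs : ∀ i ∈ s, f i ∈ I := fun i hi =>
    Finset.mem_image_of_mem f (Finset.mem_union_left t hi)
  have ht : ∀ i ∈ t, f i ∈ I := fun i hi =>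
    Finset.mem_image_of_mem f (Finset.mem_union_right s hi)
  set a : ℤ → ℝ := fun k => ((s.filter fun i => f i = k).card : ℝ) with ha
  set b : ℤ → ℝ := fun k => ((t.filter fun i => f i = k).card : ℝ) with hb
  have hnear (k : ℤ) : ((I.filter fun l => |k - l| ≤ D).card : ℝ) ≤ 2 * D + 1 := by
    have hsub : I.filter (fun l => |k - l| ≤ D) ⊆ Finset.Icc (k - D) (k + D) := by
      intro l hl
      have := abs_le.1 (Finset.mem_filter.1 hl).2
      rw [Finset.mem_Icc]; omega
    have := Finset.card_le_card hsub
    rw [Int.card_Icc] at this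
    have h2 : (I.filter fun l => |k - l| ≤ D).card ≤ 2 * D + 1 := by omega
    exact_mod_cast h2
  have h1 : ∑ i ∈ s, ((t.filter fun j => |f i - f j| ≤ D).card : ℝ) =
      ∑ k ∈ I, ∑ l ∈ I, if |k - l| ≤ D then a k * b l else 0 := by
    rw [← Finset.sum_fiberwise_of_maps_to hs]
    refine Finset.sum_congr rfl fun k _ => ?_
    have hk : ∀ i ∈ s.filter (fun i => f i = k),
        ((t.filter fun j => |f i - f j| ≤ D).card : ℝ) =
          ∑ l ∈ I, if |k - l| ≤ D then b l else 0 := by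
      intro i hi
      rw [(Finset.mem_filter.1 hi).2, Finset.card_eq_sum_card_fiberwise (f := f) (t := I)
        (fun j hj => ht j (Finset.mem_filter.1 hj).1)]
      push_cast
      refine Finset.sum_congr rfl fun l _ => ?_
      rw [Finset.filter_filter]
      split_ifs with h
      · simp only [hb]
        congr 2
        exact Finset.filter_congr fun j _ => ⟨fun h' => h'.2, fun h' => ⟨by rw [h']; exact h, h'⟩⟩
      · rw [Nat.cast_eq_zero, Finset.card_eq_zero, Finset.filter_eq_empty_iff]
        rintro j _ ⟨h', rfl⟩
        exact h h'
    rw [Finset.sum_congr rfl hk, Finset.sum_const, nsmul_eq_mul, Finset.mul_sum]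
    exact Finset.sum_congr rfl fun l _ => by rw [mul_ite, mul_zero]
  -- The inequality ab ≤ a² + b² decouples the two families; afterwards each bin has at most 2D + 1
  -- neighbours.
  have h2 : ∑ k ∈ I, ∑ l ∈ I, (if |k - l| ≤ D then a k * b l else 0) ≤
      ∑ k ∈ I, ∑ l ∈ I, ((if |k - l| ≤ D then a k ^ 2 else 0) +
        if |k - l| ≤ D then b l ^ 2 else 0) := by
    refine Finset.sum_le_sum fun k _ => Finset.sum_le_sum fun l _ => ?_
    split_ifs
    · nlinarith [sq_nonneg (a k - b l), sq_nonneg (a k), sq_nonneg (b l)]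
    · simp
  have h3 : ∑ k ∈ I, ∑ l ∈ I, (if |k - l| ≤ D then a k ^ 2 else 0) ≤
      (2 * D + 1) * ∑ k ∈ I, a k ^ 2 := by
    rw [Finset.mul_sum]
    refine Finset.sum_le_sum fun k _ => ?_
    rw [← Finset.sum_filter, Finset.sum_const, nsmul_eq_mul]
    exact mul_le_mul_of_nonneg_right (hnear k) (sq_nonneg _)
  have h4 : ∑ k ∈ I, ∑ l ∈ I, (if |k - l| ≤ D then b l ^ 2 else 0) ≤
      (2 * D + 1) * ∑ k ∈ I, b k ^ 2 := by
    rw [Finset.sum_comm, Finset.mul_sum]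
    refine Finset.sum_le_sum fun k _ => ?_
    rw [← Finset.sum_filter, Finset.sum_const, nsmul_eq_mul]
    simp_rw [abs_sub_comm _ k]
    exact mul_le_mul_of_nonneg_right (hnear k) (sq_nonneg _)
  rw [h1]
  refine h2.trans ?_
  simp only [Finset.sum_add_distrib]
  rw [← sum_card_filter_eq s f I hs, ← sum_card_filter_eq t f I ht]
  linarith

theorem sum_eq_sum_range_filter {ι : Type*} (s : Finset ι) (idx : ι → ℕ) (n : ℕ)
    (hidx : ∀ i ∈ s, idx i < n) (g : ι → ℝ) :
    ∑ i ∈ s, g i = ∑ k ∈ Finset.range n, ∑ i ∈ s.filter (fun i => idx i = k), g i :=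
  (Finset.sum_fiberwise_of_maps_to (fun i hi => Finset.mem_range.2 (hidx i hi)) g).symm

/-- Weighted count of pairs lying in nearby bins, where the bins depend symmetrically on the
classes of the two elements: it is enough to count pairs in the same class. -/
theorem sum_near_pairs_le {ι : Type*} (s : Finset ι) (idx : ι → ℕ) (n D : ℕ)
    (hidx : ∀ i ∈ s, idx i < n) (f : ℕ → ℕ → ι → ℤ) (hf : ∀ k l, f k l = f l k)
    (w : ℕ → ℕ → ℝ) (hw : ∀ k l, w k l = w l k) (hw0 : ∀ k l, 0 ≤ w k l) :
    ∑ i ∈ s, ∑ j ∈ s, (if |f (idx i) (idx j) i - f (idx i) (idx j) j| ≤ D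
        then w (idx i) (idx j) else 0) ≤
      2 * (2 * D + 1) * ∑ i ∈ s, ∑ j ∈ s.filter (fun j => idx j = idx i), ∑ l ∈ Finset.range n,
        if f (idx i) l j = f (idx i) l i then w (idx i) l else 0 := by
  classical
  set T : ℕ → Finset ι := fun k => s.filter fun i => idx i = k with hT
  set G : ℕ → ℕ → ℝ := fun k l =>
    ∑ i ∈ T k, (((T k).filter fun j => f k l j = f k l i).card : ℝ) with hG
  have hleft : ∑ i ∈ s, ∑ j ∈ s, (if |f (idx i) (idx j) i - f (idx i) (idx j) j| ≤ D
        then w (idx i) (idx j) else 0) = ∑ k ∈ Finset.range n, ∑ l ∈ Finset.range n,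
        w k l * ∑ i ∈ T k, (((T l).filter fun j => |f k l i - f k l j| ≤ D).card : ℝ) := by
    rw [sum_eq_sum_range_filter s idx n hidx]
    refine Finset.sum_congr rfl fun k _ => ?_
    simp_rw [Finset.mul_sum]
    rw [Finset.sum_comm (s := Finset.range n)]
    refine Finset.sum_congr rfl fun i hi => ?_
    rw [sum_eq_sum_range_filter s idx n hidx]
    refine Finset.sum_congr rfl fun l _ => ?_
    rw [mul_comm, ← nsmul_eq_mul, ← Finset.sum_const]
    refine Eq.trans (Finset.sum_congr rfl fun j hj => ?_) (Finset.sum_filter _ _).symm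
    rw [(Finset.mem_filter.1 hi).2, (Finset.mem_filter.1 hj).2]
  have hright : ∑ i ∈ s, ∑ j ∈ s.filter (fun j => idx j = idx i), ∑ l ∈ Finset.range n,
        (if f (idx i) l j = f (idx i) l i then w (idx i) l else 0) =
        ∑ k ∈ Finset.range n, ∑ l ∈ Finset.range n, w k l * G k l := by
    rw [sum_eq_sum_range_filter s idx n hidx]
    refine Finset.sum_congr rfl fun k _ => ?_
    simp_rw [hG, Finset.mul_sum]
    rw [Finset.sum_comm (s := Finset.range n)]
    refine Finset.sum_congr rfl fun i hi => ?_
    rw [(Finset.mem_filter.1 hi).2, Finset.sum_comm]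
    refine Finset.sum_congr rfl fun l _ => ?_
    rw [mul_comm, ← nsmul_eq_mul, ← Finset.sum_const]
    exact (Finset.sum_filter _ _).symm
  -- The symmetry of the weights lets the contribution of the second class be folded into that of
  -- the first.
  have hsym : ∑ k ∈ Finset.range n, ∑ l ∈ Finset.range n, w k l * G l k =
      ∑ k ∈ Finset.range n, ∑ l ∈ Finset.range n, w k l * G k l := by
    rw [Finset.sum_comm]
    exact Finset.sum_congr rfl fun k _ => Finset.sum_congr rfl fun l _ => by rw [hw]
  rw [hleft, hright]
  calc _ ≤ ∑ k ∈ Finset.range n, ∑ l ∈ Finset.range n,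
        (2 * D + 1) * (w k l * G k l + w k l * G l k) := by
        refine Finset.sum_le_sum fun k _ => Finset.sum_le_sum fun l _ => ?_
        have h := mul_le_mul_of_nonneg_left (sum_card_near_le (T k) (T l) (f k l) D) (hw0 k l)
        refine h.trans (le_of_eq ?_)
        simp only [hG]
        rw [hf l k]
        ring
    _ = _ := by
        simp_rw [← Finset.mul_sum, Finset.sum_add_distrib]
        rw [hsym]; ring

/-! ### Boxes, plates and cubes -/

theorem norm_le_of_abs_inner_le (e : OrthonormalBasis (Fin 3) ℝ E3) {u : E3} {a : ℝ}
    (h : ∀ k, |inner ℝ (e k) u| ≤ a) : ‖u‖ ≤ 2 * a := by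
  have ha : 0 ≤ a := (abs_nonneg _).trans (h 0)
  have hsq := e.sum_inner_mul_inner u u
  rw [real_inner_self_eq_norm_sq, Fin.sum_univ_three] at hsq
  simp_rw [real_inner_comm (e _) u] at hsq
  have hk (k : Fin 3) : inner ℝ (e k) u * inner ℝ (e k) u ≤ a ^ 2 := by
    rw [← sq]; exact sq_le_sq' (abs_le.1 (h k)).1 (abs_le.1 (h k)).2
  have h0 := hk 0
  have h1 := hk 1
  have h2 := hk 2
  nlinarith [norm_nonneg u]

theorem abs_inner_le_norm_of_basis (e : OrthonormalBasis (Fin 3) ℝ E3) (k : Fin 3) (u : E3) :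
    |inner ℝ (e k) u| ≤ ‖u‖ :=
  (abs_real_inner_le_norm _ _).trans (by rw [e.norm_eq_one, one_mul])

/-- Passing to inscribed and circumscribed balls removes the dependence on the orientation of the
cube. -/
theorem exists_closedBall_of_isAlmostBox {A s : ℝ} (e : OrthonormalBasis (Fin 3) ℝ E3)
    {q : Set E3} (hq : IsAlmostBox A e (fun _ => s) q) :
    ∃ z, Metric.closedBall z (A⁻¹ * s / 2) ⊆ q ∧ q ⊆ Metric.closedBall z (A * s) := by
  obtain ⟨z, h1, h2⟩ := hq
  refine ⟨z, fun x hx => h1 fun k => ?_, fun x hx => ?_⟩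
  · rw [Metric.mem_closedBall, dist_eq_norm] at hx
    exact (abs_inner_le_norm_of_basis e k _).trans hx
  · rw [Metric.mem_closedBall, dist_eq_norm]
    have := norm_le_of_abs_inner_le e (h2 hx)
    linarith

theorem norm_sub_le_of_mem_bigCube {R : ℝ} {x y : E3} (hx : x ∈ bigCube R)
    (hy : y ∈ bigCube R) : ‖x - y‖ ≤ 4 * R := by
  have h := norm_sq_E3 (x - y)
  have hR : 0 ≤ R := (abs_nonneg _).trans (hx 0)
  have hk (k : Fin 3) : (x - y) k ^ 2 ≤ (2 * R) ^ 2 := by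
    have h1 := abs_le.1 (hx k)
    have h2 := abs_le.1 (hy k)
    refine sq_le_sq' ?_ ?_ <;> simp only [PiLp.sub_apply] <;> linarith [h1.1, h1.2, h2.1, h2.2]
  have h0 := hk 0
  have h1 := hk 1
  have h2 := hk 2
  nlinarith [norm_nonneg (x - y)]

theorem center_mem {A : ℝ} (hA : 0 ≤ A) {e : Fin 3 → E3} {p : E3} {d : Fin 3 → ℝ}
    (hd : ∀ k, 0 ≤ d k) {B : Set E3} (h : box e p (fun i => A⁻¹ * d i) ⊆ B) : p ∈ B := by
  refine h fun k => ?_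
  rw [sub_self, inner_zero_right, abs_zero]
  exact div_nonneg (mul_nonneg (inv_nonneg.2 hA) (hd k)) zero_le_two

/-- Tubes with the same direction whose centers lie in a slab of the thickness of a plate are
contained in boundedly many plates. -/
theorem card_le_of_plates {ι : Type*} {A N : ℕ} {h c : ℝ} (hA : 1 ≤ A) (hh : 1 ≤ h)
    (s : Finset ι) (T : ι → Set E3) (p : ι → E3) (𝒮 : Set (Set E3))
    (hplate : ∀ S ∈ 𝒮, IsAlmostBox A (frenet c) ![h ^ 2, h ^ 3, h ^ 3] S)
    (hov : OverlapLE A 𝒮) (hin : ∀ i ∈ s, ∃ S ∈ 𝒮, T i ⊆ S)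
    (hN : ∀ S ∈ 𝒮, ∀ t ⊆ s, (∀ i ∈ t, T i ⊆ S) → t.card ≤ N)
    (hp : ∀ i ∈ s, p i ∈ T i)
    (hbig : ∀ i ∈ s, ∀ j ∈ s, ‖p i - p j‖ ≤ 4 * h ^ 3)
    (hslab : ∀ i ∈ s, ∀ j ∈ s, |inner ℝ (frenet c 0) (p i - p j)| ≤ h ^ 2) :
    (s.card : ℝ) ≤ 196 * A ^ 7 * N := by
  classical
  obtain ⟨e, he⟩ := exists_orthonormalBasis_frenet c
  rw [← he] at hplate hslab
  have hA' : (1 : ℝ) ≤ A := by exact_mod_cast hA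
  have h0 : 0 < h := by linarith
  choose! S hS hTS using hin
  choose! z hz1 hz2 using hplate
  have hcard : s.card ≤ N * (s.image S).card := by
    refine Finset.card_le_mul_card_image s N fun B hB => ?_
    obtain ⟨i, hi, rfl⟩ := Finset.mem_image.1 hB
    refine hN _ (hS i hi) _ (Finset.filter_subset _ _) fun j hj => ?_
    rw [Finset.mem_filter] at hj
    rw [← hj.2]
    exact hTS j hj.1
  have hmem : ∀ B ∈ s.image S, B ∈ 𝒮 := by
    intro B hB
    obtain ⟨i, hi, rfl⟩ := Finset.mem_image.1 hB
    exact hS i hi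
  -- A plate center is within half a dilated plate of a tube center. Hence the spread is h² + A h² ≤
  -- 2A h² along the tangent and 4h³ + A h³ ≤ 5A h³ in the other two directions.
  have hplates : ((s.image S).card : ℝ) ≤ A * ∏ k, ((![2 * A * h ^ 2, 5 * A * h ^ 3,
      5 * A * h ^ 3] : Fin 3 → ℝ) k / (2 * ((A : ℝ)⁻¹ * (![h ^ 2, h ^ 3, h ^ 3] : Fin 3 → ℝ) k / 2))
        + 2) := by
    refine card_le_of_overlap (s.image S) e z id _ _ A ?_ ?_ ?_ ?_ ?_
    · intro k; fin_cases k <;> simp <;> positivity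
    · intro k; fin_cases k <;> simp <;> positivity
    · intro B hB
      refine fun x hx => hz1 B (hmem B hB) fun k => ?_
      have := hx k
      simp only at this ⊢
      linarith
    · intro x t ht hx
      have hsub : (t : Set (Set E3)) ⊆ {S | S ∈ 𝒮 ∧ x ∈ S} := fun B hB =>
        ⟨hmem B (ht hB), hx B hB⟩
      have := (Set.encard_le_encard hsub).trans (hov x)
      rw [Set.encard_coe_eq_coe_finsetCard] at this
      exact_mod_cast this
    · intro B hB B' hB' k
      obtain ⟨i, hi, rfl⟩ := Finset.mem_image.1 hB
      obtain ⟨j, hj, rfl⟩ := Finset.mem_image.1 hB'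
      have h1 := hz2 _ (hS i hi) (hTS i hi (hp i hi)) k
      have h2 := hz2 _ (hS j hj) (hTS j hj (hp j hj)) k
      have h3 := (abs_inner_le_norm_of_basis e k _).trans (hbig i hi j hj)
      have h4 := hslab i hi j hj
      have hdec : inner ℝ (e k) (z (S i) - z (S j)) = inner ℝ (e k) (p i - p j) -
          inner ℝ (e k) (p i - z (S i)) + inner ℝ (e k) (p j - z (S j)) := by
        simp only [inner_sub_right]; ring
      have hAh2 : h ^ 2 ≤ A * h ^ 2 := le_mul_of_one_le_left (by positivity) hA'
      have hAh3 : h ^ 3 ≤ A * h ^ 3 := le_mul_of_one_le_left (by positivity) hA'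
      rw [hdec]
      fin_cases k <;> simp at h1 h2 h3 h4 ⊢ <;> rw [abs_le] at * <;>
        constructor <;> linarith [h1.1, h1.2, h2.1, h2.2, h3.1, h3.2, h4.1, h4.2]
  rw [Fin.prod_univ_three] at hplates
  simp only [Matrix.cons_val_zero, Matrix.cons_val_one, Matrix.cons_val] at hplates
  have e1 : 2 * A * h ^ 2 / (2 * ((A : ℝ)⁻¹ * h ^ 2 / 2)) = 2 * (A : ℝ) ^ 2 := by
    field_simp
  have e2 : 5 * A * h ^ 3 / (2 * ((A : ℝ)⁻¹ * h ^ 3 / 2)) = 5 * (A : ℝ) ^ 2 := by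
    field_simp
  rw [e1, e2] at hplates
  have hA2 : (1 : ℝ) ≤ (A : ℝ) ^ 2 := one_le_pow₀ hA'
  have hle : (A : ℝ) * ((2 * (A : ℝ) ^ 2 + 2) * (5 * (A : ℝ) ^ 2 + 2) * (5 * (A : ℝ) ^ 2 + 2)) ≤
      A * ((4 * (A : ℝ) ^ 2) * (7 * (A : ℝ) ^ 2) * (7 * (A : ℝ) ^ 2)) := by
    gcongr <;> linarith
  have hcard' : (s.card : ℝ) ≤ N * (s.image S).card := by exact_mod_cast hcard
  calc (s.card : ℝ) ≤ N * (s.image S).card := hcard'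
    _ ≤ N * (A * ((4 * (A : ℝ) ^ 2) * (7 * (A : ℝ) ^ 2) * (7 * (A : ℝ) ^ 2))) :=
        mul_le_mul_of_nonneg_left (hplates.trans hle) (Nat.cast_nonneg N)
    _ = _ := by ring

/-- The center of a cube that meets a tube is close to the axis of the tube. -/
theorem abs_inner_center_sub_le {A h c : ℝ} (hA : 1 ≤ A) (hh : 1 ≤ h) {p z : E3} {T q : Set E3}
    (hT : T ⊆ box (frenet c) p (fun i => A * (![h ^ 2, h ^ 2, h ^ 3] : Fin 3 → ℝ) i))
    (hq : q ⊆ Metric.closedBall z (A * h ^ 2)) (hTq : (T ∩ q).Nonempty) :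
    |inner ℝ (frenet c 0) (z - p)| ≤ 2 * A * h ^ 2 ∧
    |inner ℝ (frenet c 1) (z - p)| ≤ 2 * A * h ^ 2 ∧
    |inner ℝ (frenet c 2) (z - p)| ≤ 2 * A * h ^ 3 := by
  obtain ⟨e, he⟩ := exists_orthonormalBasis_frenet c
  rw [← he] at hT ⊢
  obtain ⟨x, hxT, hxq⟩ := hTq
  have hx := hq hxq
  rw [Metric.mem_closedBall, dist_eq_norm] at hx
  have hA0 : 0 < A := by linarith
  have h23 : A * h ^ 2 ≤ A * h ^ 3 := by
    gcongr; norm_num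
  have h2 : 0 ≤ A * h ^ 2 := by positivity
  have hk (k : Fin 3) : |inner ℝ (e k) (z - p)| ≤
      A * (![h ^ 2, h ^ 2, h ^ 3] : Fin 3 → ℝ) k / 2 + A * h ^ 2 := by
    have h1 := hT hxT k
    have h3 := (abs_inner_le_norm_of_basis e k _).trans hx
    have hdec : inner ℝ (e k) (z - p) = inner ℝ (e k) (x - p) - inner ℝ (e k) (x - z) := by
      simp only [inner_sub_right]; ring
    rw [hdec]
    exact (abs_sub _ _).trans (add_le_add h1 h3)
  have h0 := hk 0
  have h1 := hk 1
  have h2 := hk 2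
  simp only [Matrix.cons_val_zero, Matrix.cons_val_one, Matrix.cons_val] at h0 h1 h2
  refine ⟨?_, ?_, ?_⟩ <;> linarith

/-- Disjoint cubes meeting two tubes whose directions are `k` steps apart. -/
theorem card_cubes_le {ι : Type*} {A : ℕ} {h k c d : ℝ} (hA : 1 ≤ A) (hh : 1 ≤ h) (hk0 : 0 ≤ k)
    (hkh : k ≤ h) (hkcd : k = h * |d - c|) (hc : c ∈ Set.Icc (0 : ℝ) 1)
    (hd : d ∈ Set.Icc (0 : ℝ) 1)
    (s : Finset ι) (q : ι → Set E3) (hdisj : ∀ i ∈ s, ∀ j ∈ s, i ≠ j → Disjoint (q i) (q j))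
    (z : ι → E3) (hz1 : ∀ i ∈ s, Metric.closedBall (z i) ((A : ℝ)⁻¹ * h ^ 2 / 2) ⊆ q i)
    (hz2 : ∀ i ∈ s, q i ⊆ Metric.closedBall (z i) (A * h ^ 2))
    {T T' : Set E3} {p p' : E3}
    (hT : T ⊆ box (frenet c) p (fun i => A * (![h ^ 2, h ^ 2, h ^ 3] : Fin 3 → ℝ) i))
    (hT' : T' ⊆ box (frenet d) p' (fun i => A * (![h ^ 2, h ^ 2, h ^ 3] : Fin 3 → ℝ) i))
    (hqT : ∀ i ∈ s, (T ∩ q i).Nonempty) (hqT' : ∀ i ∈ s, (T' ∩ q i).Nonempty) :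
    (s.card : ℝ) ≤ 33200 * A ^ 6 * h * (1 + k)⁻¹ := by
  obtain ⟨e, he⟩ := exists_orthonormalBasis_frenet c
  have hA' : (1 : ℝ) ≤ A := by exact_mod_cast hA
  have h0 : 0 < h := by linarith
  have hA0 : (0 : ℝ) < A := by linarith
  have hk1 : 0 < 1 + k := by linarith
  have hsub (v : E3) (x y p : E3) {a : ℝ} (hx : |inner ℝ v (x - p)| ≤ a)
      (hy : |inner ℝ v (y - p)| ≤ a) : |inner ℝ v (x - y)| ≤ 2 * a := by
    have hdec : inner ℝ v (x - y) = inner ℝ v (x - p) - inner ℝ v (y - p) := by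
      simp only [inner_sub_right]; ring
    rw [hdec]
    exact (abs_sub _ _).trans (by linarith)
  -- Half-width A⁻¹h²/4 makes the box fit in the inscribed ball, and disjointness gives overlap 1.
  -- Along the binormal the spread is the smaller of the tube length and the angular bound: adding
  -- 4A h³ to k times it (at most 160A h³) gives 164.
  have hmain := card_le_of_overlap s e z q (fun _ => (A : ℝ)⁻¹ * h ^ 2 / 4)
    ![4 * A * h ^ 2, 4 * A * h ^ 2, 164 * A * h ^ 3 / (1 + k)] 1 (fun _ => by positivity)
    (fun i => by fin_cases i <;> simp <;> positivity) ?_ ?_ ?_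
  · rw [Fin.prod_univ_three] at hmain
    simp only [Matrix.cons_val_zero, Matrix.cons_val_one, Matrix.cons_val, Nat.cast_one,
      one_mul] at hmain
    have e1 : 4 * A * h ^ 2 / (2 * ((A : ℝ)⁻¹ * h ^ 2 / 4)) = 8 * (A : ℝ) ^ 2 := by
      field_simp; norm_num
    have e2 : 164 * A * h ^ 3 / (1 + k) / (2 * ((A : ℝ)⁻¹ * h ^ 2 / 4)) =
        328 * (A : ℝ) ^ 2 * h * (1 + k)⁻¹ := by
      field_simp; norm_num
    rw [e1, e2] at hmain
    have hA2 : (1 : ℝ) ≤ (A : ℝ) ^ 2 := one_le_pow₀ hA'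
    -- Since k ≤ h, the main term is bounded below and absorbs the additive 2.
    have hhk : 2 ≤ 4 * (A : ℝ) ^ 2 * h * (1 + k)⁻¹ := by
      rw [← div_eq_mul_inv, le_div_iff₀ hk1]
      nlinarith
    refine hmain.trans ?_
    calc _ ≤ (10 * (A : ℝ) ^ 2) * (10 * (A : ℝ) ^ 2) * (332 * (A : ℝ) ^ 2 * h * (1 + k)⁻¹) := by
          gcongr <;> linarith
      _ = _ := by ring
  · intro i hi
    refine subset_trans (fun x hx => ?_) (hz1 i hi)
    rw [Metric.mem_closedBall, dist_eq_norm]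
    have := norm_le_of_abs_inner_le e hx
    linarith
  · intro x t ht hx
    refine Finset.card_le_one.2 fun i hi j hj => ?_
    by_contra hij
    exact Set.disjoint_left.1 (hdisj i (ht hi) j (ht hj) hij) (hx i hi) (hx j hj)
  · intro i hi j hj m
    obtain ⟨a0, a1, a2⟩ := abs_inner_center_sub_le hA' hh hT (hz2 i hi) (hqT i hi)
    obtain ⟨b0, b1, b2⟩ := abs_inner_center_sub_le hA' hh hT (hz2 j hj) (hqT j hj)
    obtain ⟨a0', a1', -⟩ := abs_inner_center_sub_le hA' hh hT' (hz2 i hi) (hqT' i hi)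
    obtain ⟨b0', b1', -⟩ := abs_inner_center_sub_le hA' hh hT' (hz2 j hj) (hqT' j hj)
    have c0 := hsub _ _ _ _ a0 b0
    have c1 := hsub _ _ _ _ a1 b1
    have c2 := hsub _ _ _ _ a2 b2
    have c0' := hsub _ _ _ _ a0' b0'
    have c1' := hsub _ _ _ _ a1' b1'
    have hang := mul_le_mul_of_nonneg_left
      (abs_sub_mul_abs_inner_binormal_le hc hd c0 c1 c0' c1') h0.le
    rw [← mul_assoc, ← hkcd] at hang
    rw [he]
    fin_cases m
    · simp; linarith
    · simp; linarith
    · simp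
      rw [le_div_iff₀ hk1]
      linarith

/-- Two tubes that meet a common cube are close in the direction of their common normal. -/
theorem abs_inner_commonNormal_sub_le {A h c d : ℝ} (hA : 1 ≤ A) (hh : 1 ≤ h)
    (hc : c ∈ Set.Icc (0 : ℝ) 1) (hd : d ∈ Set.Icc (0 : ℝ) 1) {p p' z : E3} {T T' q : Set E3}
    (hT : T ⊆ box (frenet c) p (fun i => A * (![h ^ 2, h ^ 2, h ^ 3] : Fin 3 → ℝ) i))
    (hT' : T' ⊆ box (frenet d) p' (fun i => A * (![h ^ 2, h ^ 2, h ^ 3] : Fin 3 → ℝ) i))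
    (hq : q ⊆ Metric.closedBall z (A * h ^ 2))
    (hTq : (T ∩ q).Nonempty) (hTq' : (T' ∩ q).Nonempty) :
    |inner ℝ (commonNormal c d) (p - p')| ≤ 32 * A * h ^ 2 := by
  obtain ⟨a0, a1, -⟩ := abs_inner_center_sub_le hA hh hT hq hTq
  obtain ⟨b0, b1, -⟩ := abs_inner_center_sub_le hA hh hT' hq hTq'
  have h1 := abs_inner_le_of_inner_binormalDir_eq_zero
    (inner_commonNormal_binormalDir_left c d) (norm_commonNormal_le hc hd) a0 a1
  have h2 := abs_inner_le_of_inner_binormalDir_eq_zero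
    (inner_commonNormal_binormalDir_left d c) (norm_commonNormal_le hd hc) b0 b1
  rw [commonNormal_comm d c] at h2
  have hdec : inner ℝ (commonNormal c d) (p - p') =
      inner ℝ (commonNormal c d) (z - p') - inner ℝ (commonNormal c d) (z - p) := by
    simp only [inner_sub_right]; ring
  rw [hdec]
  exact (abs_sub _ _).trans (by linarith)

/-! ### The quadratic counting estimate -/

theorem sum_range_inv_one_add_abs_le {x y Y : ℝ} (hY : |y| ≤ Y) {k n m : ℕ} (hk : k < n)
    (hnm : n ≤ m) :
    ∑ l ∈ Finset.range n, (if |x + ((l : ℝ) - k) * y| ≤ 1 then (1 + |(l : ℝ) - k|)⁻¹ else 0) ≤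
      (6 + 3 * Y) * (1 + Real.log (m + 1)) * (1 + |x|)⁻¹ := by
  classical
  refine le_trans ?_ (sum_filter_inv_one_add_abs_le hY m)
  rw [← Finset.sum_filter]
  have hinj : Set.InjOn (fun l : ℕ => (l : ℤ) - k)
      ((Finset.range n).filter fun l : ℕ => |x + ((l : ℝ) - k) * y| ≤ 1) := by
    intro a _ b _ hab
    simpa using hab
  have himg := Finset.sum_image (f := fun j : ℤ => (1 + |(j : ℝ)|)⁻¹) hinj
  push_cast at himg
  rw [← himg]
  refine Finset.sum_le_sum_of_subset_of_nonneg ?_ fun _ _ _ => by positivity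
  intro j hj
  obtain ⟨l, hl, rfl⟩ := Finset.mem_image.1 hj
  rw [Finset.mem_filter, Finset.mem_range] at hl
  rw [Finset.mem_filter, Finset.mem_Icc]
  refine ⟨⟨by omega, by omega⟩, ?_⟩
  push_cast
  exact hl.2

theorem abs_inner_le_mul {u v : E3} {a b : ℝ} (hu : ‖u‖ ≤ a) (hv : ‖v‖ ≤ b) :
    |inner ℝ u v| ≤ a * b :=
  (abs_real_inner_le_norm u v).trans
    (mul_le_mul hu hv (norm_nonneg v) ((norm_nonneg u).trans hu))

/-- The quadratic counting estimate for cubes and tubes, in terms of the number `P` of tubes of a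
given direction in a slab. -/
theorem sum_sq_card_le {ι κ : Type*} {A : ℕ} {h P : ℝ} (hA : 1 ≤ A) (hh : 1 ≤ h) (hP : 0 ≤ P)
    (s : Finset ι) (idx : ι → ℕ) (T : ι → Set E3) (p : ι → E3)
    (hidx : ∀ i ∈ s, (idx i : ℝ) < h)
    (hT : ∀ i ∈ s, T i ⊆ box (frenet (idx i / h)) (p i)
      (fun k => A * (![h ^ 2, h ^ 2, h ^ 3] : Fin 3 → ℝ) k))
    (hbig : ∀ i ∈ s, ∀ j ∈ s, ‖p i - p j‖ ≤ 4 * h ^ 3)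
    (hcount : ∀ k : ℕ, ∀ t ⊆ s, (∀ i ∈ t, idx i = k) →
      (∀ i ∈ t, ∀ j ∈ t, |inner ℝ (frenet (k / h) 0) (p i - p j)| ≤ h ^ 2) → (t.card : ℝ) ≤ P)
    (Q : Finset κ) (q : κ → Set E3) (hdisj : ∀ a ∈ Q, ∀ b ∈ Q, a ≠ b → Disjoint (q a) (q b))
    (z : κ → E3) (hz1 : ∀ a ∈ Q, Metric.closedBall (z a) ((A : ℝ)⁻¹ * h ^ 2 / 2) ⊆ q a)
    (hz2 : ∀ a ∈ Q, q a ⊆ Metric.closedBall (z a) (A * h ^ 2))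
    (met : κ → Finset ι) (hmet : ∀ a i, i ∈ met a ↔ i ∈ s ∧ (T i ∩ q a).Nonempty) :
    ∑ a ∈ Q, ((met a).card : ℝ) ^ 2 ≤
      432 * 33200 * A ^ 6 * (2 * (32 * A + 1) + 1) * P * h *
        (1 + Real.log ((⌈17 * h⌉₊ : ℝ) + 1)) ^ 2 * s.card := by
  classical
  have hA' : (1 : ℝ) ≤ A := by exact_mod_cast hA
  have h0 : 0 < h := by linarith
  set L := 1 + Real.log ((⌈17 * h⌉₊ : ℝ) + 1) with hL
  have hL0 : 0 ≤ L := by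
    have := Real.log_nonneg (by linarith [(Nat.cast_nonneg ⌈17 * h⌉₊ : (0 : ℝ) ≤ _)] :
      (1 : ℝ) ≤ (⌈17 * h⌉₊ : ℝ) + 1)
    linarith
  set n := ⌈h⌉₊ with hn
  have hnm : n ≤ ⌈17 * h⌉₊ := Nat.ceil_mono (by linarith)
  have hidxn : ∀ i ∈ s, idx i < n := fun i hi => Nat.lt_ceil.2 (hidx i hi)
  have hdir : ∀ k : ℕ, (k : ℝ) < h → (k : ℝ) / h ∈ Set.Icc (0 : ℝ) 1 := fun k hk =>
    ⟨by positivity, (div_le_one h0).2 hk.le⟩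
  set C : ℝ := 33200 * A ^ 6 * h with hC
  have hC0 : 0 ≤ C := by positivity
  let f : ℕ → ℕ → ι → ℤ := fun k l i =>
    ⌊inner ℝ (commonNormal (k / h) (l / h)) (p i) / h ^ 2⌋
  let w : ℕ → ℕ → ℝ := fun k l => C * (1 + |(l : ℝ) - k|)⁻¹
  -- Expand the square into pairs of tubes. The width 32A + 1 is the separation allowed along the
  -- common normal in units of h², plus one for the floors.
  have hpairs : ∑ a ∈ Q, ((met a).card : ℝ) ^ 2 ≤ ∑ i ∈ s, ∑ j ∈ s,
      (if |f (idx i) (idx j) i - f (idx i) (idx j) j| ≤ ((32 * A + 1 : ℕ) : ℤ)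
        then w (idx i) (idx j) else 0) := by
    have hsq : ∑ a ∈ Q, ((met a).card : ℝ) ^ 2 =
        ∑ i ∈ s, ∑ j ∈ s, ((Q.filter fun a => i ∈ met a ∧ j ∈ met a).card : ℝ) := by
      have hcard (a : κ) : ((met a).card : ℝ) = ∑ i ∈ s, if i ∈ met a then 1 else 0 := by
        rw [Finset.sum_boole]
        congr 2
        ext i
        simp only [Finset.mem_filter, hmet]
        tauto
      simp_rw [sq, hcard, Finset.sum_mul_sum]
      rw [Finset.sum_comm]
      refine Finset.sum_congr rfl fun i _ => ?_
      rw [Finset.sum_comm]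
      refine Finset.sum_congr rfl fun j _ => ?_
      rw [← Finset.sum_boole]
      refine Finset.sum_congr rfl fun a _ => ?_
      by_cases hi : i ∈ met a <;> by_cases hj : j ∈ met a <;> simp [hi, hj]
    rw [hsq]
    refine Finset.sum_le_sum fun i hi => Finset.sum_le_sum fun j hj => ?_
    set F := Q.filter fun a => i ∈ met a ∧ j ∈ met a with hF
    have hmem : ∀ a ∈ F, a ∈ Q ∧ (T i ∩ q a).Nonempty ∧ (T j ∩ q a).Nonempty := by
      intro a ha
      rw [hF, Finset.mem_filter, hmet, hmet] at ha
      exact ⟨ha.1, ha.2.1.2, ha.2.2.2⟩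
    rcases F.eq_empty_or_nonempty with hFe | ⟨a, ha⟩
    · rw [hFe]
      split_ifs <;> simp [w]
      positivity
    have hdi := hdir _ (hidx i hi)
    have hdj := hdir _ (hidx j hj)
    rw [if_pos]
    · refine card_cubes_le hA hh (abs_nonneg _) ?_ ?_ hdi hdj F q
        (fun a ha b hb => hdisj a (hmem a ha).1 b (hmem b hb).1) z
        (fun a ha => hz1 a (hmem a ha).1) (fun a ha => hz2 a (hmem a ha).1) (hT i hi) (hT j hj)
        (fun a ha => (hmem a ha).2.1) (fun a ha => (hmem a ha).2.2)
      · have h1 := hidx i hi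
        have h2 := hidx j hj
        have h3 : (0 : ℝ) ≤ idx i := Nat.cast_nonneg _
        have h4 : (0 : ℝ) ≤ idx j := Nat.cast_nonneg _
        rw [abs_le]
        constructor <;> linarith
      · rw [← sub_div, abs_div, abs_of_pos h0, mul_div_cancel₀ _ h0.ne']
    · have hnear := abs_inner_commonNormal_sub_le hA' hh hdi hdj (hT i hi) (hT j hj)
        (hz2 a (hmem a ha).1) (hmem a ha).2.1 (hmem a ha).2.2
      have hfl := abs_floor_sub_floor_le
        (inner ℝ (commonNormal (idx i / h) (idx j / h)) (p i) / h ^ 2)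
        (inner ℝ (commonNormal (idx i / h) (idx j / h)) (p j) / h ^ 2)
      rw [← sub_div, ← inner_sub_right, abs_div, abs_of_pos (by positivity : 0 < h ^ 2)] at hfl
      have h2 := (div_le_iff₀ (by positivity : 0 < h ^ 2)).2 hnear
      have h3 := hfl.trans (add_le_add_left h2 1)
      exact_mod_cast h3
  refine hpairs.trans ((sum_near_pairs_le s idx n (32 * A + 1) hidxn f ?_ w ?_ ?_).trans ?_)
  · intro k l
    funext i
    simp only [f, commonNormal_comm]
  · intro k l
    simp only [w, abs_sub_comm]
  · intro k l
    positivity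
  -- Only parallel tubes i, j remain. One logarithm comes from the sum over auxiliary directions l,
  -- with 54 = 6 + 3·16, and one from the sum over j.
  have hinner : ∀ i ∈ s, ∑ j ∈ s.filter (fun j => idx j = idx i), ∑ l ∈ Finset.range n,
      (if f (idx i) l j = f (idx i) l i then w (idx i) l else 0) ≤ C * (54 * L) * (4 * P * L) := by
    intro i hi
    set c : ℝ := idx i / h with hc
    have hci : c ∈ Set.Icc (0 : ℝ) 1 := hdir _ (hidx i hi)
    set x : ι → ℝ := fun j => inner ℝ (velocity c) (p j - p i) / h ^ 2 with hx
    have hterm : ∀ j ∈ s.filter (fun j => idx j = idx i), ∑ l ∈ Finset.range n,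
        (if f (idx i) l j = f (idx i) l i then w (idx i) l else 0) ≤
        C * (54 * L) * (1 + |x j|)⁻¹ := by
      intro j hj
      have hjs := (Finset.mem_filter.1 hj).1
      -- The divisor is h³ rather than h² because consecutive directions differ by 1/h.
      set y : ℝ := inner ℝ (transverse c) (p j - p i) / h ^ 3 with hy
      have hyY : |y| ≤ 16 := by
        rw [hy, abs_div, abs_of_pos (by positivity : 0 < h ^ 3), div_le_iff₀ (by positivity)]
        have := abs_inner_le_mul (norm_transverse_le hci) (hbig j hjs i hi)
        linarith
      have hsum := sum_range_inv_one_add_abs_le (x := x j) hyY (hidxn i hi) hnm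
      rw [← hL] at hsum
      calc _ ≤ ∑ l ∈ Finset.range n, C * (if |x j + ((l : ℝ) - idx i) * y| ≤ 1
            then (1 + |(l : ℝ) - idx i|)⁻¹ else 0) := by
            refine Finset.sum_le_sum fun l _ => ?_
            by_cases hfl : f (idx i) l j = f (idx i) l i
            · rw [if_pos hfl, if_pos]
              have h1 := (Int.abs_sub_lt_one_of_floor_eq_floor hfl).le
              rw [← sub_div, ← inner_sub_right, inner_commonNormal] at h1
              refine le_of_eq_of_le (congrArg _ ?_) h1
              simp only [hx, hy, hc]
              field_simp
            · rw [if_neg hfl]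
              split_ifs <;> positivity
        _ ≤ C * ((6 + 3 * 16) * L * (1 + |x j|)⁻¹) := by
            rw [← Finset.mul_sum]
            exact mul_le_mul_of_nonneg_left hsum hC0
        _ = _ := by ring
    refine (Finset.sum_le_sum hterm).trans ?_
    rw [← Finset.mul_sum]
    refine mul_le_mul_of_nonneg_left ?_ (by positivity)
    refine sum_inv_one_add_abs_le _ x _ hP (fun j hj => ?_) fun m => ?_
    · have hjs := (Finset.mem_filter.1 hj).1
      have h1 := abs_inner_le_mul (norm_velocity_le hci) (hbig j hjs i hi)
      have h2 : |x j| ≤ 16 * h := by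
        rw [hx]
        simp only
        rw [abs_div, abs_of_pos (by positivity : 0 < h ^ 2), div_le_iff₀ (by positivity)]
        linarith
      linarith [Nat.le_ceil (17 * h)]
    · refine hcount (idx i) _ ((Finset.filter_subset _ _).trans (Finset.filter_subset _ _))
        (fun j hj => (Finset.mem_filter.1 (Finset.mem_filter.1 hj).1).2) fun j hj j' hj' => ?_
      have hfl := (Finset.mem_filter.1 hj).2.trans (Finset.mem_filter.1 hj').2.symm
      have h1 := (Int.abs_sub_lt_one_of_floor_eq_floor hfl).le
      simp only [hx] at h1
      rw [← sub_div, ← inner_sub_right, abs_div, abs_of_pos (by positivity : 0 < h ^ 2),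
        div_le_one (by positivity), sub_sub_sub_cancel_right] at h1
      -- As |Γ'| ≥ 1, a slab of thickness h² measured against Γ' is no thicker when measured against
      -- the unit tangent.
      have h2 : frenet (idx i / h) 0 = unit (velocity c) := tangentVec_eq c
      rw [h2, unit, real_inner_smul_left, abs_mul]
      refine (mul_le_of_le_one_left (abs_nonneg _) ?_).trans h1
      rw [abs_inv, abs_norm]
      exact inv_le_one_of_one_le₀ (one_le_norm_velocity c)
  have hsum := Finset.sum_le_card_nsmul s _ _ hinner
  rw [nsmul_eq_mul] at hsum
  refine (mul_le_mul_of_nonneg_left hsum (by positivity)).trans (le_of_eq ?_)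
  rw [hC]
  push_cast
  ring

/-! ### Spacing condition, scale h = R^{1/3}, and conclusion -/

/-- Because h³ ≥ 2, log h is bounded away from 0, so its multiple absorbs the additive constants. -/
theorem one_add_log_ceil_le {h : ℝ} (hh : 1 ≤ h) (h2 : 2 ≤ h ^ 3) :
    1 + Real.log ((⌈17 * h⌉₊ : ℝ) + 1) ≤ 7 * Real.log (h ^ 3) := by
  have h0 : 0 < h := by linarith
  have h1 : (⌈17 * h⌉₊ : ℝ) + 1 ≤ 19 * h := by
    have := Nat.ceil_lt_add_one (by positivity : 0 ≤ 17 * h)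
    linarith
  have h3 : Real.log ((⌈17 * h⌉₊ : ℝ) + 1) ≤ Real.log 19 + Real.log h := by
    rw [← Real.log_mul (by norm_num) h0.ne']
    exact Real.log_le_log (by positivity) h1
  have h4 : Real.log 19 ≤ 3 := by
    rw [Real.log_le_iff_le_exp (by norm_num)]
    have h5 := Real.exp_one_gt_d9
    have h6 : Real.exp 3 = Real.exp 1 ^ 3 := by rw [← Real.exp_nat_mul]; norm_num
    rw [h6]
    have h7 : (2.718 : ℝ) ^ 3 ≤ Real.exp 1 ^ 3 := by gcongr; linarith
    norm_num at h7 ⊢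
    linarith
  have h5 := Real.log_le_log two_pos h2
  have h6 := Real.log_two_gt_d9
  have h7 : Real.log (h ^ 3) = 3 * Real.log h := by rw [Real.log_pow]; norm_num
  linarith

/-- The number of tubes of a given direction with centers in a slab, under the spacing
condition. -/
theorem card_le_of_spacing {A N : ℕ} {h R : ℝ} (hA : 1 ≤ A) (hh : 1 ≤ h) (hR : h ^ 3 = R)
    (hR2 : R ^ (2 / 3 : ℝ) = h ^ 2) {𝕋 : Finset (ℝ × Set E3)}
    (hS : SpacingS1 A R N 𝕋) (hsub : ∀ τ ∈ 𝕋, τ.2 ⊆ bigCube R) (p : ℝ × Set E3 → E3)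
    (hp : ∀ τ ∈ 𝕋, p τ ∈ τ.2) {c : ℝ} (hc : c ∈ leftEndpoints R)
    (t : Finset (ℝ × Set E3)) (ht : t ⊆ 𝕋) (htc : ∀ τ ∈ t, τ.1 = c)
    (hslab : ∀ τ ∈ t, ∀ τ' ∈ t, |inner ℝ (frenet c 0) (p τ - p τ')| ≤ h ^ 2) :
    (t.card : ℝ) ≤ 196 * A ^ 7 * N := by
  obtain ⟨𝒮, hplate, hov, -, hin, hN⟩ := hS c hc
  refine card_le_of_plates hA hh t Prod.snd p 𝒮 ?_ hov ?_ ?_ (fun τ hτ => hp τ (ht hτ)) ?_ hslab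
  · intro S hS
    have := hplate S hS
    rwa [IsPlate, hR2, ← hR] at this
  · intro τ hτ
    refine hin τ.2 ?_
    rw [tubesAt, Set.mem_ofPred_eq, ← htc τ hτ]
    exact ht hτ
  · intro S hS u hu hTS
    -- With the direction fixed, tagged tubes are determined by their sets, so the count of sets in
    -- the spacing condition applies to them.
    have hinj : Set.InjOn Prod.snd (u : Set (ℝ × Set E3)) := fun a ha b hb hab =>
      Prod.ext ((htc a (hu ha)).trans (htc b (hu hb)).symm) hab
    have himg : Prod.snd '' (u : Set (ℝ × Set E3)) ⊆ {T | T ∈ tubesAt 𝕋 c ∧ T ⊆ S} := by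
      rintro _ ⟨τ, hτ, rfl⟩
      refine ⟨?_, hTS τ hτ⟩
      rw [tubesAt, Set.mem_ofPred_eq, ← htc τ (hu hτ)]
      exact ht (hu hτ)
    have := (Set.encard_le_encard himg).trans (hN S hS)
    rw [hinj.encard_image, Set.encard_coe_eq_coe_finsetCard] at this
    exact_mod_cast this
  · intro τ hτ τ' hτ'
    rw [hR]
    exact norm_sub_le_of_mem_bigCube (hsub τ (ht hτ) (hp τ (ht hτ)))
      (hsub τ' (ht hτ') (hp τ' (ht hτ')))

/-- The estimate for finite families of cubes. -/
theorem card_cubes_mul_sq_le {A N : ℕ} {R r : ℝ} (hA : 1 ≤ A) (hR : 2 ≤ R)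
    {𝕋 : Finset (ℝ × Set E3)} (h𝕋 : IsSeparatedTubeFamily A R 𝕋) (hS : SpacingS1 A R N 𝕋)
    (hr : 0 ≤ r) (𝒬 : Finset (Set E3))
    (hdisj : ∀ q ∈ 𝒬, ∀ q' ∈ 𝒬, q ≠ q' → Disjoint q q')
    (h𝒬 : ∀ q ∈ 𝒬, IsCube A R q ∧ IsRich 𝕋 r q) :
    𝒬.card * r ^ 2 ≤ 432 * 33200 * 196 * 49 * A ^ 13 * (2 * (32 * A + 1) + 1) *
      Real.log R ^ 2 * (𝕋.card * N * R ^ (1 / 3 : ℝ)) := by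
  classical
  have hA' : (1 : ℝ) ≤ A := by exact_mod_cast hA
  have hR0 : 0 ≤ R := by linarith
  set h := R ^ (1 / 3 : ℝ) with hh
  have hh1 : 1 ≤ h := Real.one_le_rpow (by linarith) (by norm_num)
  have h0 : 0 < h := by linarith
  have hhR : h ^ 3 = R := by
    rw [hh, ← Real.rpow_natCast, ← Real.rpow_mul hR0]; norm_num
  have hR2 : R ^ (2 / 3 : ℝ) = h ^ 2 := by
    rw [hh, ← Real.rpow_natCast, ← Real.rpow_mul hR0]; norm_num
  have hRinv : R ^ (-(1 / 3) : ℝ) = h⁻¹ := by rw [hh, Real.rpow_neg hR0]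
  have hidx : ∀ τ ∈ 𝕋, ∃ k : ℕ, (k : ℝ) < h ∧ τ.1 = k / h := by
    intro τ hτ
    obtain ⟨hlt, k, hk⟩ := (h𝕋.tube τ hτ).1
    rw [hRinv, ← div_eq_mul_inv] at hk
    rw [hk, div_lt_one h0] at hlt
    exact ⟨k, hlt, hk⟩
  have hcen : ∀ τ ∈ 𝕋, ∃ p : E3, p ∈ τ.2 ∧
      τ.2 ⊆ box (frenet τ.1) p (fun k => A * (![h ^ 2, h ^ 2, h ^ 3] : Fin 3 → ℝ) k) := by
    intro τ hτ
    obtain ⟨p, hp1, hp2⟩ := (h𝕋.tube τ hτ).2.1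
    rw [hR2, ← hhR] at hp1 hp2
    refine ⟨p, center_mem (by linarith) (fun k => ?_) hp1, hp2⟩
    fin_cases k <;> simp <;> positivity
  choose! idx hidxh hidxc using hidx
  choose! p hpT hpbox using hcen
  have hball : ∀ q ∈ 𝒬, ∃ z, Metric.closedBall z ((A : ℝ)⁻¹ * h ^ 2 / 2) ⊆ q ∧
      q ⊆ Metric.closedBall z (A * h ^ 2) := by
    intro q hq
    obtain ⟨e, he⟩ := (h𝒬 q hq).1
    rw [hR2] at he
    exact exists_closedBall_of_isAlmostBox e he
  choose! z hz1 hz2 using hball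
  have hsub : ∀ τ ∈ 𝕋, τ.2 ⊆ bigCube R := fun τ hτ => (h𝕋.tube τ hτ).2.2
  have hmain := sum_sq_card_le (P := 196 * A ^ 7 * N) hA hh1 (by positivity) 𝕋 idx Prod.snd p
    hidxh (fun τ hτ => by rw [← hidxc τ hτ]; exact hpbox τ hτ)
    (fun τ hτ τ' hτ' => by
      rw [hhR]
      exact norm_sub_le_of_mem_bigCube (hsub τ hτ (hpT τ hτ)) (hsub τ' hτ' (hpT τ' hτ')))
    (fun k t ht htk hslab => by
      rcases t.eq_empty_or_nonempty with rfl | ⟨τ, hτ⟩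
      · rw [Finset.card_empty, Nat.cast_zero]; positivity
      have hck : ∀ τ ∈ t, τ.1 = k / h := fun τ hτ => by rw [hidxc τ (ht hτ), htk τ hτ]
      exact card_le_of_spacing hA hh1 hhR hR2 hS hsub p hpT
        (hck τ hτ ▸ (h𝕋.tube τ (ht hτ)).1) t ht hck hslab)
    𝒬 id hdisj z hz1 hz2 (fun q => 𝕋.filter fun τ => (τ.2 ∩ q).Nonempty)
    (fun q τ => by rw [Finset.mem_filter]; rfl)
  have hrich : ∀ q ∈ 𝒬, r ^ 2 ≤ ((𝕋.filter fun τ => (τ.2 ∩ q).Nonempty).card : ℝ) ^ 2 := by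
    intro q hq
    have h1 := (h𝒬 q hq).2
    rw [IsRich, ← Finset.coe_filter, Set.ncard_coe_finset] at h1
    exact pow_le_pow_left₀ hr h1 2
  have hlow := Finset.card_nsmul_le_sum 𝒬 _ _ hrich
  rw [nsmul_eq_mul] at hlow
  have hlog := one_add_log_ceil_le hh1 (by rw [hhR]; exact hR)
  rw [hhR] at hlog
  have hlog0 : 0 ≤ 1 + Real.log ((⌈17 * h⌉₊ : ℝ) + 1) := by
    have := Real.log_nonneg (by linarith [(Nat.cast_nonneg ⌈17 * h⌉₊ : (0 : ℝ) ≤ _)] :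
      (1 : ℝ) ≤ (⌈17 * h⌉₊ : ℝ) + 1)
    linarith
  have hlog2 := pow_le_pow_left₀ hlog0 hlog 2
  calc 𝒬.card * r ^ 2 ≤ _ := hlow.trans hmain
    _ ≤ 432 * 33200 * A ^ 6 * (2 * (32 * A + 1) + 1) * (196 * A ^ 7 * N) * h *
        (7 * Real.log R) ^ 2 * 𝕋.card := by gcongr
    _ = _ := by ring

/-- An infinite set would contain a finite subset with ⌊M⌋ + 1 elements. Finiteness of the cube
family therefore comes from the uniform bound on finite subfamilies. -/
theorem finite_and_ncard_le {α : Type*} {s : Set α} {M : ℝ}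
    (h : ∀ t : Finset α, (t : Set α) ⊆ s → (t.card : ℝ) ≤ M) : s.Finite ∧ (s.ncard : ℝ) ≤ M := by
  have hfin : s.Finite := by
    by_contra hinf
    obtain ⟨t, ht, hcard⟩ := Set.Infinite.exists_subset_card_eq hinf (⌊M⌋₊ + 1)
    have h1 := h t ht
    rw [hcard] at h1
    push_cast at h1
    linarith [Nat.lt_floor_add_one M]
  refine ⟨hfin, ?_⟩
  have := h hfin.toFinset (by simp)
  rwa [← Set.ncard_eq_toFinset_card s hfin] at this

end Vinogradov
end

theorem mainTheorem6 :
    ∃ B : ℕ, ∀ A : ℕ, 1 ≤ A → ∃ K : ℝ, 0 < K ∧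
      ∀ (R : ℝ), 2 ≤ R →
      ∀ (𝕋 : Finset (ℝ × Set Vinogradov.E3)) (N : ℕ),
        Vinogradov.IsSeparatedTubeFamily A R 𝕋 →
        Vinogradov.SpacingS1 A R N 𝕋 →
      ∀ (r : ℝ), 1 ≤ r →
      ∀ (𝒬 : Set (Set Vinogradov.E3)),
        𝒬.PairwiseDisjoint id →
        (∀ q ∈ 𝒬, Vinogradov.IsCube A R q ∧ Vinogradov.IsRich 𝕋 r q) →
        𝒬.Finite ∧
        (𝒬.ncard : ℝ) ≤
          K * Real.log R ^ B * ((𝕋.card : ℝ) * (N : ℝ) * R ^ (1 / 3 : ℝ) / r ^ 2) := by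
  refine ⟨2, fun A hA =>
    ⟨432 * 33200 * 196 * 49 * A ^ 13 * (2 * (32 * A + 1) + 1), ?_, ?_⟩⟩
  · have hA' : (0 : ℝ) < A := by exact_mod_cast hA
    positivity
  intro R hR 𝕋 N h𝕋 hS r hr 𝒬 hdisj h𝒬
  refine Vinogradov.finite_and_ncard_le fun t ht => ?_
  rw [← mul_div_assoc, le_div_iff₀ (by positivity)]
  exact Vinogradov.card_cubes_mul_sq_le hA hR h𝕋 hS (by linarith) t
    (fun q hq q' hq' hne => hdisj (ht hq) (ht hq') hne) fun q hq => h𝒬 q (ht hq)
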